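/- **Notation.** For an ideal $I\subseteq\mathbb R[X]=\mathbb R[X_1,\dots,X_n]$ let $\mathbf V_{\mathbb C}(I)\subseteq\mathbb C^n$ be its set of complex zeros, and let $\dim(I)$ be its Hilbert dimension, i.e. the degree of the affine Hilbert polynomial of $I$ (the polynomial that agrees with $s\mapsto\dim_{\mathbb R}\bigl(\mathbb R[X]_{\le s}/(I\cap\mathbb R[X]_{\le s})\bigr)$ for all large $s$, where $\mathbb R[X]_{\le s}$ is the space of polynomials of total degree at most $s$). Let $\|X\|_2^2=X_1^2+\cdots+X_n^2$ and, for a real number $r$, $\mathsf S_{r,\mathbb C}=\{x\in\mathbb C^n : x_1^2+\cdots+x_n^2=r^2\}$. Let $I\subseteq\mathbb R[X]$ be an ideal with $\dim(I)=1$. Let $I=I^{(0)}\cap I^{(1)}$ be any equidimensional decomposition, i.e. for $i=0,1$ all associated primes of $I^{(i)}$ have dimension $i$ ($I^{(0)}=\mathbb R[X]$ is allowed, when there is no zero-dimensional component). Let $g_1,\dots,g_s$ be any generators of the radical $\sqrt{I^{(1)}}$, let $\mathscr D$ be the set of the determinants of the Jacobian matrices of $(g_{i_1},\dots,g_{i_{n-1}},\|X\|_2^2)$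 for all $i_1<\cdots<i_{n-1}$ in $\{1,\dots,s\}$, and let $\Delta_{I^{(1)}}=\{g_1,\dots,g_s\}\cup\mathscr D$. Put $$\mathscr R_{I^{(0)}}=\inf\{r>0 : \mathbf V_{\mathbb C}(I^{(0)})\cap\mathsf S_{r,\mathbb C}\ne\emptyset\},\qquad \mathscr R_{I^{(1)}}=\inf\{r>0 : \mathbf V_{\mathbb C}(\Delta_{I^{(1)}})\cap\mathsf S_{r,\mathbb C}\ne\emptyset\},$$ $$\mathscr R_I=\min\{\mathscr R_{I^{(0)}},\mathscr R_{I^{(1)}}\}\in[0,+\infty],$$ where $r$ ranges over real numbers and $\inf\emptyset=+\infty$. **Proposition.** For every real $R$ with $0<R<\mathscr R_I$, the set $\mathbf V_{\mathbb C}(I)\cap\mathsf S_{R,\mathbb C}$ is finite, i.e. the system is zero-dimensional. -/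

import Mathlib

open MvPolynomial

noncomputable section

namespace TangencyRadius

/-- The affine Hilbert function of an ideal `I ⊆ ℝ[X₁, …, Xₙ]`:
`s ↦ dim_ℝ (ℝ[X]_{≤ s} / I_{≤ s})`, where `ℝ[X]_{≤ s}` is the space of polynomials of total degree
at most `s` and `I_{≤ s} = I ∩ ℝ[X]_{≤ s}`. -/
def affineHilbertFunction {n : ℕ} (I : Ideal (MvPolynomial (Fin n) ℝ)) (s : ℕ) : ℕ :=
  Module.finrank ℝ (restrictTotalDegree (Fin n) ℝ s ⧸
    (I.restrictScalars ℝ).submoduleOf (restrictTotalDegree (Fin n) ℝ s))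

/-- `p` is the affine Hilbert polynomial of `I`: it agrees with the affine Hilbert function of `I`
at all sufficiently large integers. -/
def IsAffineHilbertPolynomial {n : ℕ} (I : Ideal (MvPolynomial (Fin n) ℝ))
    (p : Polynomial ℚ) : Prop :=
  ∀ᶠ s : ℕ in Filter.atTop, (affineHilbertFunction I s : ℚ) = p.eval (s : ℚ)

/-- `dim(I) = d` for the Hilbert dimension: the affine Hilbert polynomial of `I` has degree `d`. -/
def HasHilbertDim {n : ℕ} (I : Ideal (MvPolynomial (Fin n) ℝ)) (d : ℕ) : Prop :=
  ∃ p : Polynomial ℚ, IsAffineHilbertPolynomial I p ∧ p.degree = d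

/-- `I` is pure of dimension `d`: every associated prime of `I` has Hilbert dimension `d`.
The unit ideal, which has no associated prime, is allowed; it stands for an absent component. -/
def IsPureDim {n : ℕ} (I : Ideal (MvPolynomial (Fin n) ℝ)) (d : ℕ) : Prop :=
  ∀ P ∈ associatedPrimes (MvPolynomial (Fin n) ℝ) (MvPolynomial (Fin n) ℝ ⧸ I), HasHilbertDim P d

/-- `I = I₀ ∩ I₁` is an equidimensional decomposition of an ideal of dimension one. -/
structure IsEquidimDecomp {n : ℕ} (I I₀ I₁ : Ideal (MvPolynomial (Fin n) ℝ)) : Prop where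
  eq_inf : I = I₀ ⊓ I₁
  pure_zero : IsPureDim I₀ 0
  pure_one : IsPureDim I₁ 1

/-- The polynomial `‖X‖₂² = X₁² + ⋯ + Xₙ²`. -/
def normSqPoly (n : ℕ) : MvPolynomial (Fin n) ℝ := ∑ i, X i ^ 2

/-- The Jacobian matrix of a tuple of `n` polynomials in `n` variables. -/
def jacobian {n : ℕ} (h : Fin n → MvPolynomial (Fin n) ℝ) :
    Matrix (Fin n) (Fin n) (MvPolynomial (Fin n) ℝ) :=
  Matrix.of fun i j => pderiv j (h i)

/-- The tuple `(g_{i₁}, …, g_{iₙ₋₁}, ‖X‖₂²)` for indices `i₁ < ⋯ < iₙ₋₁`. -/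
def tuple {n s : ℕ} (g : Fin s → MvPolynomial (Fin n) ℝ) (i : Fin (n - 1) ↪o Fin s) :
    Fin n → MvPolynomial (Fin n) ℝ :=
  fun j => if hj : (j : ℕ) < n - 1 then g (i ⟨j, hj⟩) else normSqPoly n

/-- The set of the determinants of the Jacobian matrices of `(g_{i₁}, …, g_{iₙ₋₁}, ‖X‖₂²)`, for all
`(n-1)`-element subsets `{i₁ < ⋯ < iₙ₋₁}` of the index set of `g`. -/
def jacobianDets {n s : ℕ} (g : Fin s → MvPolynomial (Fin n) ℝ) :
    Set (MvPolynomial (Fin n) ℝ) :=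
  Set.range fun i : Fin (n - 1) ↪o Fin s => (jacobian (tuple g i)).det

/-- The set `Δ = {g₁, …, gₛ} ∪ 𝒟`, with `𝒟` the set of Jacobian determinants. -/
def criticalSystem {n s : ℕ} (g : Fin s → MvPolynomial (Fin n) ℝ) :
    Set (MvPolynomial (Fin n) ℝ) :=
  Set.range g ∪ jacobianDets g

/-- The complex sphere `{x ∈ ℂⁿ | x₁² + ⋯ + xₙ² = r²}` (squares, not squared moduli). -/
def complexSphere (n : ℕ) (r : ℝ) : Set (Fin n → ℂ) :=
  {x | ∑ i, x i ^ 2 = (r : ℂ) ^ 2}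

/-- The infimum of all real `r > 0` for which `V ⊆ ℂⁿ` meets the complex sphere of radius `r`;
it is `+∞` if there is no such `r`. -/
def leastRadius {n : ℕ} (V : Set (Fin n → ℂ)) : EReal :=
  sInf {ρ : EReal | ∃ r : ℝ, 0 < r ∧ (∃ x ∈ V, x ∈ complexSphere n r) ∧ ρ = (r : EReal)}

/-- The radius `𝓡_I = min {𝓡_{I⁽⁰⁾}, 𝓡_{I⁽¹⁾}}`, computed from the zero-dimensional part `I₀` of an
equidimensional decomposition of `I` and from generators `g` of the radical of its
one-dimensional part. -/
def radius {n s : ℕ} (I₀ : Ideal (MvPolynomial (Fin n) ℝ))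
    (g : Fin s → MvPolynomial (Fin n) ℝ) : EReal :=
  min (leastRadius (zeroLocus ℂ I₀)) (leastRadius (zeroLocus ℂ (Ideal.span (criticalSystem g))))

end TangencyRadius

end

/-! Let `x` be a point of V(I) on the sphere of radius `R`. As `R` is below both least radii, `x`
avoids V(I₀), which forces every `g i` to vanish at `x`, and `x` is not critical, so some Jacobian
determinant of n-1 of the `g i` and ‖X‖² is nonzero there. Over ℂ, let J be generated by all `g i`
and ‖X‖² - R². The linear terms of these n equations span 𝔪/𝔪² at `x`, so 𝔪 ≤ J + 𝔪²
(`ker_eval_le_sup_sq`), and Nakayama makes 𝔪 a minimal prime over J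
(`mem_minimalPrimes_of_le_sup_sq`). A Noetherian ring has finitely many of these, and 𝔪 determines
`x`. No dimension theory enters. -/

namespace TangencyRadius

/-- First-order Taylor expansion of a polynomial at a point, modulo the square of the maximal ideal
of that point. -/
theorem sub_linearPart_mem_sq {σ K : Type*} [Fintype σ] [Field K] (x : σ → K)
    (p : MvPolynomial σ K) :
    p - C (eval x p) - ∑ j, C (eval x (pderiv j p)) * (X j - C (x j)) ∈
      RingHom.ker (eval x) ^ 2 := by
  classical
  have hX (j : σ) : (X j - C (x j) : MvPolynomial σ K) ∈ RingHom.ker (eval x) := by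
    simp [RingHom.mem_ker]
  induction p using MvPolynomial.induction_on with
  | C a => simp
  | add p q hp hq =>
    convert add_mem hp hq using 1
    simp only [map_add, add_mul, Finset.sum_add_distrib]
    ring
  | mul_X p k hp =>
    -- The remainder of `p * X k` is this product plus `x k` times the remainder of `p`.
    have hpk : (p - C (eval x p)) * (X k - C (x k)) ∈ RingHom.ker (eval x) ^ 2 := by
      rw [pow_two]
      exact Ideal.mul_mem_mul (by simp [RingHom.mem_ker]) (hX k)
    convert add_mem hpk (Ideal.mul_mem_right (C (x k)) _ hp) using 1
    have hsum : ∑ j, C (eval x (pderiv j (p * X k))) * (X j - C (x j)) =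
        C (eval x p) * (X k - C (x k)) +
          (∑ j, C (eval x (pderiv j p)) * (X j - C (x j))) * C (x k) := by
      simp only [pderiv_mul, pderiv_X, map_add, map_mul, eval_X, add_mul, Finset.sum_add_distrib,
        Finset.sum_mul]
      rw [add_comm]
      congr 1
      · rw [Finset.sum_eq_single k]
        · simp
        · intro j _ hj
          simp [hj.symm]
        · simp
      · exact Finset.sum_congr rfl fun j _ => by ring
    rw [hsum]
    simp only [map_mul, eval_X]
    ring

/-- If an ideal `J` contains `n` polynomials vanishing at `x` with invertible Jacobian matrix at
`x`, then the maximal ideal `𝔪` of `x` satisfies `𝔪 ≤ J + 𝔪²`. -/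
theorem ker_eval_le_sup_sq {σ K : Type*} [Fintype σ] [DecidableEq σ] [Field K] (x : σ → K)
    (J : Ideal (MvPolynomial σ K)) (f : σ → MvPolynomial σ K) (hf : ∀ i, f i ∈ J)
    (hfx : ∀ i, eval x (f i) = 0)
    (hdet : (Matrix.of fun i j => eval x (pderiv j (f i))).det ≠ 0) :
    RingHom.ker (eval x) ≤ J ⊔ RingHom.ker (eval x) ^ 2 := by
  set L := J ⊔ RingHom.ker (eval x) ^ 2
  set M : Matrix σ σ K := Matrix.of fun i j => eval x (pderiv j (f i)) with hM
  have hrow (i : σ) : ∑ j, C (M i j) * (X j - C (x j)) ∈ L := by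
    have h := (le_sup_right : _ ≤ L) (sub_linearPart_mem_sq x (f i))
    rw [hfx, C_0, sub_zero] at h
    simpa [hM] using L.sub_mem ((le_sup_left : J ≤ L) (hf i)) h
  have hX (k : σ) : (X k - C (x k) : MvPolynomial σ K) ∈ L := by
    -- Row `k` of `M⁻¹` combines the linear parts in `hrow` into the single coordinate `X k - C (x
    -- k)`.
    have hinv : M⁻¹ * M = 1 := Matrix.nonsing_inv_mul M (isUnit_iff_ne_zero.mpr hdet)
    have h : ∑ i, C (M⁻¹ k i) * ∑ j, C (M i j) * (X j - C (x j)) ∈ L :=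
      sum_mem fun i _ => L.mul_mem_left _ (hrow i)
    have heq : ∑ i, C (M⁻¹ k i) * ∑ j, C (M i j) * (X j - C (x j)) =
        ∑ j, C ((M⁻¹ * M) k j) * (X j - C (x j)) := by
      simp only [Finset.mul_sum, Matrix.mul_apply, map_sum, map_mul, Finset.sum_mul, mul_assoc]
      exact Finset.sum_comm
    rw [heq, hinv, Finset.sum_eq_single k] at h
    · simpa using h
    · intro j _ hj
      simp [hj.symm]
    · simp
  intro p hp
  have h := (le_sup_right : _ ≤ L) (sub_linearPart_mem_sq x p)
  rw [(RingHom.mem_ker).mp hp, C_0, sub_zero] at h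
  have hlin : ∑ j, C (eval x (pderiv j p)) * (X j - C (x j)) ∈ L :=
    sum_mem fun j _ => L.mul_mem_left _ (hX j)
  simpa using L.add_mem h hlin

/-- A maximal ideal `m ≥ J` with `m ≤ J + m²` is a minimal prime over `J`. -/
theorem mem_minimalPrimes_of_le_sup_sq {A : Type*} [CommRing A] [IsNoetherianRing A]
    {J m : Ideal A} [hm : m.IsPrime] (hJ : J ≤ m) (h : m ≤ J ⊔ m ^ 2) :
    m ∈ J.minimalPrimes := by
  refine ⟨⟨hm, hJ⟩, fun P ⟨hP, hJP⟩ hPm => ?_⟩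
  have hle : m ≤ P ⊔ m • m := by
    rw [smul_eq_mul, ← pow_two]
    exact h.trans (sup_le_sup_right hJP _)
  -- Nakayama: some `r` congruent to 1 modulo `m` has `r • m ≤ P`. It lies outside `m`, hence
  -- outside `P`, so primality of `P` gives `m ≤ P`.
  obtain ⟨r, hr, hrm⟩ := Submodule.exists_sub_one_mem_and_smul_le_of_fg_of_le_sup
    (IsNoetherian.noetherian m) le_rfl hle
  have hrm' : r ∉ m := fun hmem => hm.ne_top <| (Ideal.eq_top_iff_one m).mpr <| by
    simpa using m.sub_mem hmem hr
  intro a ha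
  exact (hP.mem_or_mem (hrm (Submodule.smul_mem_pointwise_smul a r m ha))).resolve_left
    fun hrP => hrm' (hPm hrP)

theorem ker_eval_injective {σ K : Type*} [Field K] :
    Function.Injective fun x : σ → K => RingHom.ker (eval x) := by
  intro x y hxy
  funext j
  have h : (X j - C (x j) : MvPolynomial σ K) ∈ RingHom.ker (eval y) := by
    rw [← show RingHom.ker (eval x) = RingHom.ker (eval y) from hxy]
    simp [RingHom.mem_ker]
  simpa [RingHom.mem_ker, sub_eq_zero, eq_comm] using h

/-- A set of points at each of which some `n` elements of an ideal vanishing on the set have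
invertible Jacobian matrix is finite. -/
theorem finite_of_jacobian_ne_zero {σ K : Type*} [Fintype σ] [DecidableEq σ] [Field K]
    (J : Ideal (MvPolynomial σ K)) (W : Set (σ → K)) (hW : ∀ x ∈ W, ∀ p ∈ J, eval x p = 0)
    (hdet : ∀ x ∈ W, ∃ f : σ → MvPolynomial σ K, (∀ i, f i ∈ J) ∧
      (Matrix.of fun i j => eval x (pderiv j (f i))).det ≠ 0) :
    W.Finite := by
  refine Set.Finite.of_finite_image (f := fun x : σ → K => RingHom.ker (eval x))
    (J.finite_minimalPrimes_of_isNoetherianRing.subset ?_) ker_eval_injective.injOn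
  rintro _ ⟨x, hx, rfl⟩
  obtain ⟨f, hf, hd⟩ := hdet x hx
  have : (RingHom.ker (eval x)).IsPrime := RingHom.ker_isPrime _
  exact mem_minimalPrimes_of_le_sup_sq (hW x hx)
    (ker_eval_le_sup_sq x J f hf (fun i => hW x hx _ (hf i)) hd)

theorem leastRadius_le {n : ℕ} {V : Set (Fin n → ℂ)} {R : ℝ} (hR : 0 < R) {x : Fin n → ℂ}
    (hxV : x ∈ V) (hx : x ∈ complexSphere n R) : leastRadius V ≤ R :=
  sInf_le ⟨R, hR, ⟨x, hxV, hx⟩, rfl⟩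

theorem aeval_normSqPoly {n : ℕ} (x : Fin n → ℂ) : aeval x (normSqPoly n) = ∑ i, x i ^ 2 := by
  simp [normSqPoly]

theorem exists_jacobianDet_ne_zero {n s : ℕ} {g : Fin s → MvPolynomial (Fin n) ℝ}
    {x : Fin n → ℂ} (hg : ∀ i, aeval x (g i) = 0)
    (hx : x ∉ zeroLocus ℂ (Ideal.span (criticalSystem g))) :
    ∃ i : Fin (n - 1) ↪o Fin s, aeval x (jacobian (tuple g i)).det ≠ 0 := by
  contrapose! hx
  rw [zeroLocus_span]
  rintro p (⟨i, rfl⟩ | ⟨i, rfl⟩)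
  · exact hg i
  · exact hx i

/-- The points of a sphere that lie on `V(g)` but are not critical for `‖X‖²` on `V(g)` are finite
in number. -/
theorem finite_of_notMem_criticalSystem {n s : ℕ} (g : Fin s → MvPolynomial (Fin n) ℝ) (R : ℝ)
    (W : Set (Fin n → ℂ)) (hg : ∀ x ∈ W, ∀ i, aeval x (g i) = 0) (hS : W ⊆ complexSphere n R)
    (hW : ∀ x ∈ W, x ∉ zeroLocus ℂ (Ideal.span (criticalSystem g))) :
    W.Finite := by
  let J : Ideal (MvPolynomial (Fin n) ℂ) := Ideal.span
    (Set.range (fun i => map (algebraMap ℝ ℂ) (g i)) ∪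
      {map (algebraMap ℝ ℂ) (normSqPoly n) - C ((R : ℂ) ^ 2)})
  refine finite_of_jacobian_ne_zero J W (fun x hx => ?_) fun x hx => ?_
  · have hJ : J ≤ RingHom.ker (eval x) := by
      refine Ideal.span_le.mpr ?_
      rintro _ (⟨i, rfl⟩ | rfl)
      · simpa [RingHom.mem_ker, eval_map, aeval_def] using hg x hx i
      · have h := hS hx
        rw [complexSphere, Set.mem_ofPred_eq, ← aeval_normSqPoly, aeval_def] at h
        simp only [SetLike.mem_coe, RingHom.mem_ker, map_sub, eval_map, eval_C, h, sub_self]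
    exact fun p hp => hJ hp
  · obtain ⟨i, hi⟩ := exists_jacobianDet_ne_zero (hg x hx) (hW x hx)
    -- Subtracting R² from the last entry puts the tuple in `J` and leaves all partial derivatives
    -- unchanged.
    refine ⟨fun j => map (algebraMap ℝ ℂ) (tuple g i j) -
      C (if (j : ℕ) < n - 1 then 0 else (R : ℂ) ^ 2), fun j => ?_, ?_⟩
    · by_cases hj : (j : ℕ) < n - 1
      · have h : map (algebraMap ℝ ℂ) (g (i ⟨j, hj⟩)) ∈ J :=
          Ideal.subset_span (Or.inl ⟨i ⟨j, hj⟩, rfl⟩)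
        simpa [tuple, hj] using h
      · have h : map (algebraMap ℝ ℂ) (normSqPoly n) - C ((R : ℂ) ^ 2) ∈ J :=
          Ideal.subset_span (Or.inr rfl)
        simpa [tuple, hj] using h
    · convert hi using 1
      rw [AlgHom.map_det]
      congr 1
      ext k l
      simp [jacobian, pderiv_map, eval_map, aeval_def]

end TangencyRadius

theorem proposition5p2 {n : ℕ} (I I₀ I₁ : Ideal (MvPolynomial (Fin n) ℝ))
    (hdim : TangencyRadius.HasHilbertDim I 1)
    (hdecomp : TangencyRadius.IsEquidimDecomp I I₀ I₁)
    {s : ℕ} (g : Fin s → MvPolynomial (Fin n) ℝ)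
    (hg : Ideal.span (Set.range g) = I₁.radical)
    (R : ℝ) (hR : 0 < R) (hRI : (R : EReal) < TangencyRadius.radius I₀ g) :
    (MvPolynomial.zeroLocus ℂ I ∩ TangencyRadius.complexSphere n R).Finite := by
  obtain ⟨hR₀, hR₁⟩ := lt_min_iff.mp hRI
  refine TangencyRadius.finite_of_notMem_criticalSystem g R _ (fun x hx i => ?_)
    Set.inter_subset_right fun x hx hcrit =>
      hR₁.not_ge (TangencyRadius.leastRadius_le hR hcrit hx.2)
  have hx₀ : x ∉ zeroLocus ℂ I₀ := fun h =>
    hR₀.not_ge (TangencyRadius.leastRadius_le hR h hx.2)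
  simp only [mem_zeroLocus_iff, not_forall] at hx₀
  obtain ⟨p, hp, hpx⟩ := hx₀
  have hgi : g i ∈ I₁.radical := hg ▸ Ideal.subset_span ⟨i, rfl⟩
  obtain ⟨k, hk⟩ := hgi
  -- The product lies in both components, so it vanishes at `x`; since `p` does not, `g i` must.
  have hmem : p * g i ^ k ∈ I := hdecomp.eq_inf ▸
    ⟨I₀.mul_mem_right _ hp, I₁.mul_mem_left _ hk⟩
  have h := hx.1 _ hmem
  rw [map_mul, map_pow] at h
  exact eq_zero_of_pow_eq_zero ((mul_eq_zero.mp h).resolve_left hpx)
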